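/- Let $n\ge 1$ and let $z\in\mathbb{C}^n$ be a deterministic vector with $|z_1|=\dots=|z_n|=1$. Let $W\in\mathbb{C}^{n\times n}$ be a random Hermitian matrix with zero diagonal whose entries $W_{ij}$, $i<j$, above the diagonal are independent and follow the standard complex normal distribution (the law of $X+iY$ with $X,Y$ independent real normal variables of mean $0$ and variance $1/2$). Thus $W_{ii}=0$, $W_{ij}=\overline{W_{ji}}$, and, for $i\ne j$, $\mathbb{E}W_{ij}=0$ and $\mathbb{E}|W_{ij}|^2=1$. Then, with probability at least $$1-2n^{-5/4}-e^{-n/2},$$ $W$ is $z$-discordant, that is, $W$ is Hermitian and satisfies both $$\|W\|_{\mathrm{op}}\le 3\sqrt{n}\qquad\text{and}\qquad \|Wz\|_\infty\le 3\sqrt{n\log n},$$ where $\|W\|_{\mathrm{op}}$ is the maximal singular value of $W$ and $\|v\|_\infty=\max_i|v_i|$. -/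

import Mathlib

open MeasureTheory ProbabilityTheory
open scoped Matrix NNReal

/-- The standard complex normal distribution: the law of `X + i Y` with `X`, `Y` independent real
normal variables of mean `0` and variance `1/2` each, so that the total variance is `1`. -/
noncomputable def stdComplexNormal : Measure ℂ :=
  ((gaussianReal 0 (1 / 2 : ℝ≥0)).prod (gaussianReal 0 (1 / 2 : ℝ≥0))).map
    (fun p : ℝ × ℝ => (⟨p.1, p.2⟩ : ℂ))

/-- `W` is a random Hermitian matrix with zero diagonal whose entries above the diagonal are
independent standard complex normal variables. -/
structure IsComplexWigner {Ω : Type*} [MeasurableSpace Ω] (μ : Measure Ω) {n : ℕ}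
    (W : Ω → Matrix (Fin n) (Fin n) ℂ) : Prop where
  isHermitian : ∀ᵐ ω ∂μ, (W ω).IsHermitian
  diag_eq_zero : ∀ᵐ ω ∂μ, ∀ i, W ω i i = 0
  hasLaw : ∀ i j, i < j → HasLaw (fun ω => W ω i j) stdComplexNormal μ
  iIndepFun : iIndepFun
    (fun (p : {p : Fin n × Fin n // p.1 < p.2}) (ω : Ω) => W ω p.1.1 p.1.2) μ

/-- `W` is `z`-discordant: it is Hermitian, its operator norm for the Euclidean norm of `ℂⁿ` (its
maximal singular value) is at most `3 √n`, and the sup norm of `W z` is at most `3 √(n log n)`.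
The norm of `Fin n → ℂ` is the sup norm. -/
structure IsDiscordant {n : ℕ} (z : Fin n → ℂ) (W : Matrix (Fin n) (Fin n) ℂ) : Prop where
  isHermitian : W.IsHermitian
  opNorm_le : ‖Matrix.toEuclideanCLM (n := Fin n) (𝕜 := ℂ) W‖ ≤ 3 * √(n : ℝ)
  supNorm_mulVec_le : ‖W *ᵥ z‖ ≤ 3 * √((n : ℝ) * Real.log n)

open scoped ENNReal

/-! Almost surely `W` is a function of its entries above the diagonal, so both bounds become
estimates under a product of standard complex normals, combined by a union bound.

Sup norm: each `Re (ζ (Wz)ᵢ)` with `|ζ| = 1` is a real linear functional of the entries with squared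
coefficient sum at most `n`. Chernoff's bound in the four directions `ζ = 1, I, -1, -I`, for all `n`
coordinates, gives a failure probability of at most `4n · n^(-9/2)`.

Operator norm: a Gaussian average over vectors replaces a net of the sphere. For fixed `x`, the
Rayleigh quotient has exponential moment at most `exp (s²/2)`
(`lintegral_exp_hermitianRayleigh_le`), and Fubini keeps this bound when `x` is an independent
Gaussian vector. If instead `‖W‖ > R`, every `x` in a cone around an extremal eigenvector has
Rayleigh quotient at least `R(1-2d)` up to sign, and this cone has probability exactly `d^(n-1)`
(`stdComplexNormalVec_cone`). So a large norm forces a large average over `x`, which Markov's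
inequality makes unlikely. -/

/-! ### The standard complex normal: density, transforms and tail. -/

instance isProbabilityMeasure_stdComplexNormal : IsProbabilityMeasure stdComplexNormal := by
  unfold stdComplexNormal
  exact Measure.isProbabilityMeasure_map
    Complex.measurableEquivRealProd.symm.measurable.aemeasurable

theorem stdComplexNormal_eq_map :
    stdComplexNormal = ((gaussianReal 0 (1 / 2 : ℝ≥0)).prod (gaussianReal 0 (1 / 2 : ℝ≥0))).map
      Complex.measurableEquivRealProd.symm := rfl

theorem measurePreserving_stdComplexNormal :
    MeasurePreserving Complex.measurableEquivRealProd.symm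
      ((gaussianReal 0 (1 / 2 : ℝ≥0)).prod (gaussianReal 0 (1 / 2 : ℝ≥0))) stdComplexNormal :=
  ⟨Complex.measurableEquivRealProd.symm.measurable, rfl⟩

theorem gaussianPDFReal_zero_half (x : ℝ) :
    gaussianPDFReal 0 (1 / 2 : ℝ≥0) x = (√Real.pi)⁻¹ * Real.exp (-x ^ 2) := by
  rw [gaussianPDFReal]
  congr 2
  · congr 1; push_cast; ring
  · push_cast; ring

theorem norm_sq_measurableEquivRealProd_symm (p : ℝ × ℝ) :
    ‖Complex.measurableEquivRealProd.symm p‖ ^ 2 = p.1 ^ 2 + p.2 ^ 2 := by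
  rw [← Complex.normSq_eq_norm_sq, Complex.normSq_apply]
  simp [Complex.measurableEquivRealProd_symm_apply, sq]

theorem stdComplexNormal_eq_withDensity :
    stdComplexNormal =
      volume.withDensity fun z : ℂ => ENNReal.ofReal (Real.pi⁻¹ * Real.exp (-‖z‖ ^ 2)) := by
  have h2 : (1 / 2 : ℝ≥0) ≠ 0 := by norm_num
  rw [stdComplexNormal_eq_map, gaussianReal_of_var_ne_zero _ h2,
    prod_withDensity (measurable_gaussianPDF _ _) (measurable_gaussianPDF _ _)]
  ext s hs
  rw [Measure.map_apply (MeasurableEquiv.measurable _) hs,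
    withDensity_apply _ (MeasurableEquiv.measurable _ hs), withDensity_apply _ hs,
    ← (Complex.volume_preserving_equiv_real_prod.symm).setLIntegral_comp_preimage hs (by fun_prop)]
  refine lintegral_congr fun p => ?_
  rw [gaussianPDF, gaussianPDF, ← ENNReal.ofReal_mul (gaussianPDFReal_nonneg _ _ _),
    gaussianPDFReal_zero_half, gaussianPDFReal_zero_half]
  congr 1
  rw [norm_sq_measurableEquivRealProd_symm, mul_mul_mul_comm, ← Real.exp_add, ← mul_inv, Real.mul_self_sqrt Real.pi_pos.le]
  ring_nf

theorem lintegral_exp_mul_gaussianReal_half (t : ℝ) :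
    ∫⁻ x, ENNReal.ofReal (Real.exp (t * x)) ∂gaussianReal 0 (1 / 2 : ℝ≥0) =
      ENNReal.ofReal (Real.exp (t ^ 2 / 4)) := by
  rw [← ofReal_integral_eq_lintegral_ofReal (integrable_exp_mul_gaussianReal t)
    (.of_forall fun _ => (Real.exp_pos _).le)]
  have := congrFun (mgf_fun_id_gaussianReal (μ := 0) (v := (1 / 2 : ℝ≥0))) t
  rw [mgf] at this
  rw [this]
  congr 2
  push_cast; ring

/-- The moment generating function of a real linear functional of a standard complex normal. -/
theorem lintegral_exp_re_mul_stdComplexNormal (c : ℂ) :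
    ∫⁻ z, ENNReal.ofReal (Real.exp (c * z).re) ∂stdComplexNormal =
      ENNReal.ofReal (Real.exp (‖c‖ ^ 2 / 4)) := by
  rw [← measurePreserving_stdComplexNormal.lintegral_comp (by fun_prop)]
  have : ∀ p : ℝ × ℝ, ENNReal.ofReal
      (Real.exp (c * Complex.measurableEquivRealProd.symm p).re) =
      ENNReal.ofReal (Real.exp (c.re * p.1)) * ENNReal.ofReal (Real.exp (-c.im * p.2)) := by
    intro p
    rw [← ENNReal.ofReal_mul (Real.exp_pos _).le, ← Real.exp_add]
    simp [Complex.measurableEquivRealProd_symm_apply, sub_eq_add_neg]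
  simp_rw [this]
  rw [lintegral_prod_mul (f := fun x : ℝ => ENNReal.ofReal (Real.exp (c.re * x)))
      (g := fun x : ℝ => ENNReal.ofReal (Real.exp (-c.im * x))) (by fun_prop) (by fun_prop),
    lintegral_exp_mul_gaussianReal_half,
    lintegral_exp_mul_gaussianReal_half, ← ENNReal.ofReal_mul (Real.exp_pos _).le, ← Real.exp_add,
    ← Complex.normSq_eq_norm_sq, Complex.normSq_apply]
  congr 2
  ring

theorem lintegral_pi_prod {ι : Type*} [Fintype ι] {E : ι → Type*} [∀ i, MeasurableSpace (E i)]
    (μ : ∀ i, Measure (E i)) [∀ i, IsProbabilityMeasure (μ i)] (f : ∀ i, E i → ℝ≥0∞)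
    (hf : ∀ i, Measurable (f i)) :
    ∫⁻ x, ∏ i, f i (x i) ∂Measure.pi μ = ∏ i, ∫⁻ x, f i x ∂μ i := by
  have h := (iIndepFun_pi (μ := μ) (X := f) fun i => (hf i).aemeasurable)
  rw [lintegral_prod_eq_prod_lintegral_of_indepFun Finset.univ _ h (fun i => by fun_prop)]
  refine Finset.prod_congr rfl fun i _ => ?_
  exact (measurePreserving_eval μ i).lintegral_comp (hf i)

theorem lintegral_exp_sum_re_mul_pi {ι : Type*} [Fintype ι] (c : ι → ℂ) :
    ∫⁻ X, ENNReal.ofReal (Real.exp (∑ p, (c p * X p).re))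
        ∂Measure.pi (fun _ : ι => stdComplexNormal) =
      ENNReal.ofReal (Real.exp ((∑ p, ‖c p‖ ^ 2) / 4)) := by
  simp_rw [Real.exp_sum]
  simp_rw [ENNReal.ofReal_prod_of_nonneg fun i _ => (Real.exp_pos _).le]
  rw [lintegral_pi_prod _ (fun p z => ENNReal.ofReal (Real.exp (c p * z).re))
    fun _ => by fun_prop]
  simp_rw [lintegral_exp_re_mul_stdComplexNormal]
  rw [← ENNReal.ofReal_prod_of_nonneg fun i _ => (Real.exp_pos _).le, ← Real.exp_sum,
    Finset.sum_div]

theorem charFun_stdComplexNormal (t : ℂ) :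
    charFun stdComplexNormal t = Complex.exp (-(‖t‖ ^ 2 / 4 : ℝ)) := by
  rw [charFun_apply, ← measurePreserving_stdComplexNormal.integral_comp'
    (g := fun x : ℂ => Complex.exp (inner ℝ x t * Complex.I))]
  have : ∀ p : ℝ × ℝ, Complex.exp (inner ℝ (Complex.measurableEquivRealProd.symm p) t * Complex.I) =
      Complex.exp (t.re * p.1 * Complex.I) * Complex.exp (t.im * p.2 * Complex.I) := by
    intro p
    rw [← Complex.exp_add, Complex.inner]
    congr 1
    simp [Complex.measurableEquivRealProd_symm_apply]
    ring
  simp_rw [this]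
  rw [integral_prod_mul (fun x : ℝ => Complex.exp (t.re * x * Complex.I))
    (fun x : ℝ => Complex.exp (t.im * x * Complex.I)), ← charFun_apply_real, ← charFun_apply_real,
    charFun_gaussianReal, charFun_gaussianReal, ← Complex.exp_add,
    ← Complex.normSq_eq_norm_sq, Complex.normSq_apply]
  congr 1
  push_cast
  ring

theorem lintegral_exp_neg_mul_norm_sq_stdComplexNormal {k : ℝ} (hk : 0 ≤ k) :
    ∫⁻ z, ENNReal.ofReal (Real.exp (-(k * ‖z‖ ^ 2))) ∂stdComplexNormal =
      ENNReal.ofReal (1 + k)⁻¹ := by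
  rw [stdComplexNormal_eq_withDensity, lintegral_withDensity_eq_lintegral_mul _ (by fun_prop)
    (by fun_prop)]
  have h1 : 0 < 1 + k := by positivity
  have : ∀ z : ℂ, ((fun z : ℂ => ENNReal.ofReal (Real.pi⁻¹ * Real.exp (-‖z‖ ^ 2))) *
      fun z : ℂ => ENNReal.ofReal (Real.exp (-(k * ‖z‖ ^ 2)))) z =
      ENNReal.ofReal (Real.pi⁻¹ * Real.exp (-(1 + k) * ‖z‖ ^ 2)) := by
    intro z
    simp only [Pi.mul_apply]
    rw [← ENNReal.ofReal_mul (by positivity), mul_assoc, ← Real.exp_add]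
    ring_nf
  simp_rw [this]
  have hI : ∫ v : ℂ, Real.exp (-(1 + k) * ‖v‖ ^ 2) = Real.pi / (1 + k) := by
    have := GaussianFourier.integral_rexp_neg_mul_sq_norm (V := ℂ) h1
    simpa using this
  rw [← ofReal_integral_eq_lintegral_ofReal, integral_const_mul, hI]
  · congr 1; field_simp
  · refine Integrable.const_mul ?_ _
    refine Integrable.of_integral_ne_zero ?_
    rw [hI]; positivity
  · exact .of_forall fun _ => by positivity

/-- In polar coordinates the radial density is `2 r exp (-r²)`, with explicit primitive: the squared
modulus is exponential of rate 1. This makes the cone probability exactly computable. -/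
theorem stdComplexNormal_norm_sq_gt (R : ℝ) (hR : 0 ≤ R) :
    stdComplexNormal {z | R < ‖z‖ ^ 2} = ENNReal.ofReal (Real.exp (-R)) := by
  have hm : MeasurableSet {z : ℂ | R < ‖z‖ ^ 2} := measurableSet_lt (by fun_prop) (by fun_prop)
  have hs := Real.sq_sqrt hR
  have hderiv : ∀ x : ℝ, HasDerivAt (fun x => -Real.exp (-x ^ 2) / (2 * Real.pi))
      (x * (Real.pi⁻¹ * Real.exp (-x ^ 2))) x := by
    intro x
    have := ((((hasDerivAt_pow 2 x).neg).exp).neg).div_const (2 * Real.pi)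
    convert! this using 1
    simp
    field_simp
  have hlim : Filter.Tendsto (fun x : ℝ => -Real.exp (-x ^ 2) / (2 * Real.pi)) Filter.atTop
      (nhds 0) := by
    have h1 : Filter.Tendsto (fun x : ℝ => -x ^ 2) Filter.atTop Filter.atBot :=
      Filter.tendsto_neg_atTop_atBot.comp (Filter.tendsto_pow_atTop two_ne_zero)
    simpa using ((Real.tendsto_exp_atBot.comp h1).neg).div_const (2 * Real.pi)
  have hnn : ∀ x ∈ Set.Ioi √R, 0 ≤ x * (Real.pi⁻¹ * Real.exp (-x ^ 2)) := fun x hx =>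
    mul_nonneg ((Real.sqrt_nonneg R).trans hx.le) (by positivity)
  have hI := integral_Ioi_of_hasDerivAt_of_nonneg' (a := √R) (fun x _ => hderiv x) hnn hlim
  have hInt := integrableOn_Ioi_deriv_of_nonneg' (a := √R) (fun x _ => hderiv x) hnn hlim
  have hmeas : Measurable fun p : ℝ × ℝ => ENNReal.ofReal p.1 • {z : ℂ | R < ‖z‖ ^ 2}.indicator
      (fun z => ENNReal.ofReal (Real.pi⁻¹ * Real.exp (-‖z‖ ^ 2))) (Complex.polarCoord.symm p) := by
    refine Measurable.smul (f := fun p : ℝ × ℝ => ENNReal.ofReal p.1) (by fun_prop) ?_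
    refine Measurable.comp (Measurable.indicator
      (f := fun z => ENNReal.ofReal (Real.pi⁻¹ * Real.exp (-‖z‖ ^ 2))) (by fun_prop) hm) ?_
    rw [funext Complex.polarCoord_symm_apply]; fun_prop
  rw [stdComplexNormal_eq_withDensity, withDensity_apply _ hm, ← lintegral_indicator hm,
    ← Complex.lintegral_comp_polarCoord_symm, polarCoord_target, Measure.volume_eq_prod,
    setLIntegral_prod _ hmeas.aemeasurable]
  have : ∀ x ∈ Set.Ioi (0 : ℝ), ∫⁻ y in Set.Ioo (-Real.pi) Real.pi, ENNReal.ofReal x •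
      {z : ℂ | R < ‖z‖ ^ 2}.indicator
        (fun z => ENNReal.ofReal (Real.pi⁻¹ * Real.exp (-‖z‖ ^ 2)))
        (Complex.polarCoord.symm (x, y)) =
      ENNReal.ofReal (2 * Real.pi) * (Set.Ioi √R).indicator
        (fun x => ENNReal.ofReal (x * (Real.pi⁻¹ * Real.exp (-x ^ 2)))) x := by
    intro x hx
    have hx0 : 0 < x := hx
    have : ∀ y, ENNReal.ofReal x • {z : ℂ | R < ‖z‖ ^ 2}.indicator
        (fun z => ENNReal.ofReal (Real.pi⁻¹ * Real.exp (-‖z‖ ^ 2)))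
        (Complex.polarCoord.symm (x, y)) = (Set.Ioi √R).indicator
        (fun x => ENNReal.ofReal (x * (Real.pi⁻¹ * Real.exp (-x ^ 2)))) x := by
      intro y
      simp only [Set.indicator, Set.mem_ofPred_eq, Complex.norm_polarCoord_symm, sq_abs,
        Set.mem_Ioi, Real.sqrt_lt' hx0]
      split_ifs
      · rw [smul_eq_mul, ENNReal.ofReal_mul hx0.le]
      · simp
    simp_rw [this]
    rw [setLIntegral_const, Real.volume_Ioo, mul_comm]
    congr 2
    ring
  rw [setLIntegral_congr_fun measurableSet_Ioi this, lintegral_const_mul _ (by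
      exact Measurable.indicator (by fun_prop) measurableSet_Ioi),
    ← lintegral_indicator measurableSet_Ioi]
  have h3 : ∫⁻ x, (Set.Ioi (0 : ℝ)).indicator ((Set.Ioi √R).indicator
        (fun x => ENNReal.ofReal (x * (Real.pi⁻¹ * Real.exp (-x ^ 2))))) x =
      ∫⁻ x in Set.Ioi √R, ENNReal.ofReal (x * (Real.pi⁻¹ * Real.exp (-x ^ 2))) := by
    rw [Set.indicator_indicator, lintegral_indicator (measurableSet_Ioi.inter measurableSet_Ioi)]
    rw [Set.Ioi_inter_Ioi, sup_eq_right.2 (Real.sqrt_nonneg R)]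
  rw [h3, ← ofReal_integral_eq_lintegral_ofReal hInt
    ((ae_restrict_iff' measurableSet_Ioi).2 (.of_forall hnn)), hI,
    ← ENNReal.ofReal_mul (by positivity), hs]
  congr 1
  field_simp
  ring

/-! ### Gaussian vectors: unitary invariance and the probability of a cone. -/

/-- The standard complex normal distribution on `ℂⁿ` with its Euclidean norm. -/
noncomputable def stdComplexNormalVec (n : ℕ) : Measure (EuclideanSpace ℂ (Fin n)) :=
  (Measure.pi fun _ : Fin n => stdComplexNormal).map (WithLp.toLp 2)

theorem measurePreserving_toLp_stdComplexNormalVec (n : ℕ) :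
    MeasurePreserving (MeasurableEquiv.toLp 2 (Fin n → ℂ))
      (Measure.pi fun _ : Fin n => stdComplexNormal) (stdComplexNormalVec n) :=
  ⟨MeasurableEquiv.measurable _, rfl⟩

instance isProbabilityMeasure_stdComplexNormalVec (n : ℕ) :
    IsProbabilityMeasure (stdComplexNormalVec n) :=
  Measure.isProbabilityMeasure_map (MeasurableEquiv.toLp 2 (Fin n → ℂ)).measurable.aemeasurable

theorem charFun_stdComplexNormalVec {n : ℕ} (t : EuclideanSpace ℂ (Fin n)) :
    charFun (stdComplexNormalVec n) t = Complex.exp (-(‖t‖ ^ 2 / 4 : ℝ)) := by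
  rw [stdComplexNormalVec, charFun_pi]
  simp_rw [charFun_stdComplexNormal]
  rw [← Complex.exp_sum, EuclideanSpace.norm_sq_eq]
  congr 1
  push_cast
  rw [Finset.sum_neg_distrib, Finset.sum_div]

/-- The characteristic function depends on `‖t‖` alone, and it determines the measure. -/
theorem map_stdComplexNormalVec {n : ℕ}
    (U : EuclideanSpace ℂ (Fin n) ≃ₗᵢ[ℂ] EuclideanSpace ℂ (Fin n)) :
    (stdComplexNormalVec n).map U = stdComplexNormalVec n := by
  have hU : Measurable U := U.continuous.measurable
  have : IsProbabilityMeasure ((stdComplexNormalVec n).map U) :=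
    Measure.isProbabilityMeasure_map hU.aemeasurable
  refine Measure.ext_of_charFun (funext fun t => ?_)
  have key : charFun ((stdComplexNormalVec n).map U) t =
      charFun (stdComplexNormalVec n) (U.symm t) := by
    rw [charFun_apply, charFun_apply, integral_map hU.aemeasurable (by fun_prop)]
    congr 1
    ext x
    congr 3
    have h : ∀ x y : EuclideanSpace ℂ (Fin n), inner ℝ x y = (inner ℂ x y).re := fun x y => by
      simp [PiLp.inner_apply, Complex.inner, mul_comm]
    rw [h, h, ← U.symm.inner_map_map, U.symm_apply_apply]
  rw [key, charFun_stdComplexNormalVec, charFun_stdComplexNormalVec, U.symm.norm_map]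

/-- The probability that a standard complex normal vector of length `n + 1` is aligned with the
first coordinate axis, up to a share `d` of its squared norm, is `d ^ n`. -/
theorem pi_stdComplexNormal_cone (n : ℕ) {d : ℝ} (hd : 0 < d) (hd1 : d ≤ 1) :
    Measure.pi (fun _ : Fin (n + 1) => stdComplexNormal)
      {x | ∑ i, ‖x i‖ ^ 2 - ‖x 0‖ ^ 2 < d * ∑ i, ‖x i‖ ^ 2} = ENNReal.ofReal (d ^ n) := by
  -- With this `k` the cone reads `k * ∑_{i ≥ 1} ‖x i‖² < ‖x 0‖²`, and `(1 + k)⁻¹ = d`.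
  set k := (1 - d) / d with hk
  have hk0 : 0 ≤ k := div_nonneg (by linarith) hd.le
  have hS : MeasurableSet {p : ℂ × (Fin n → ℂ) | k * ∑ i, ‖p.2 i‖ ^ 2 < ‖p.1‖ ^ 2} :=
    measurableSet_lt (by fun_prop) (by fun_prop)
  have hpre : {x : Fin (n + 1) → ℂ | ∑ i, ‖x i‖ ^ 2 - ‖x 0‖ ^ 2 < d * ∑ i, ‖x i‖ ^ 2} =
      MeasurableEquiv.piFinSuccAbove (fun _ => ℂ) 0 ⁻¹'
        {p : ℂ × (Fin n → ℂ) | k * ∑ i, ‖p.2 i‖ ^ 2 < ‖p.1‖ ^ 2} := by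
    ext x
    simp only [Set.mem_ofPred_eq, Set.mem_preimage, MeasurableEquiv.piFinSuccAbove_apply,
      Fin.sum_univ_succ, Fin.insertNthEquiv_zero, Fin.consEquiv_symm_apply, Fin.tail]
    rw [hk, div_mul_eq_mul_div, div_lt_iff₀ hd]
    constructor <;> intro h <;> linarith
  rw [hpre, (measurePreserving_piFinSuccAbove (fun _ : Fin (n + 1) => stdComplexNormal)
    0).measure_preimage hS.nullMeasurableSet, Measure.prod_apply_symm hS]
  -- Given the other coordinates, the exponential tail of `‖x 0‖²` factors over them; each factor
  -- then integrates to `(1 + k)⁻¹`.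
  have : ∀ y : Fin n → ℂ, stdComplexNormal
      ((fun a => (a, y)) ⁻¹' {p : ℂ × (Fin n → ℂ) | k * ∑ i, ‖p.2 i‖ ^ 2 < ‖p.1‖ ^ 2}) =
      ∏ i, ENNReal.ofReal (Real.exp (-(k * ‖y i‖ ^ 2))) := by
    intro y
    rw [← ENNReal.ofReal_prod_of_nonneg fun i _ => (Real.exp_pos _).le, ← Real.exp_sum,
      Finset.sum_neg_distrib, ← Finset.mul_sum]
    exact stdComplexNormal_norm_sq_gt (k * ∑ i, ‖y i‖ ^ 2) (by positivity)
  simp_rw [this]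
  rw [lintegral_pi_prod _ (fun _ z => ENNReal.ofReal (Real.exp (-(k * ‖z‖ ^ 2))))
    fun _ => by fun_prop]
  simp_rw [lintegral_exp_neg_mul_norm_sq_stdComplexNormal hk0]
  have : (1 + k)⁻¹ = d := by rw [hk]; field_simp; ring
  rw [this, Finset.prod_const, Finset.card_univ, Fintype.card_fin, ENNReal.ofReal_pow hd.le]

/-- Completing `v` to an orthonormal basis gives a unitary map that carries this cone to the one
around the first axis; the Gaussian measure is invariant under it. -/
theorem stdComplexNormalVec_cone (n : ℕ) {d : ℝ} (hd : 0 < d) (hd1 : d ≤ 1)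
    {v : EuclideanSpace ℂ (Fin (n + 1))} (hv : ‖v‖ = 1) :
    stdComplexNormalVec (n + 1) {x | ‖x‖ ^ 2 - ‖inner ℂ v x‖ ^ 2 < d * ‖x‖ ^ 2} =
      ENNReal.ofReal (d ^ n) := by
  have hon : Orthonormal ℂ (Set.domRestrict {(0 : Fin (n + 1))}
      (fun _ : Fin (n + 1) => v)) := by
    rw [orthonormal_iff_ite]
    rintro ⟨i, rfl⟩ ⟨j, rfl⟩
    simp [hv]
  obtain ⟨b, hb⟩ := hon.exists_orthonormalBasis_extension_of_card_eq (by simp)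
  have hb0 : b 0 = v := hb 0 rfl
  have hS : MeasurableSet {x : EuclideanSpace ℂ (Fin (n + 1)) |
      ‖x‖ ^ 2 - ‖x 0‖ ^ 2 < d * ‖x‖ ^ 2} := measurableSet_lt (by fun_prop) (by fun_prop)
  have hpre : {x : EuclideanSpace ℂ (Fin (n + 1)) |
      ‖x‖ ^ 2 - ‖inner ℂ v x‖ ^ 2 < d * ‖x‖ ^ 2} =
      b.repr ⁻¹' {x | ‖x‖ ^ 2 - ‖x 0‖ ^ 2 < d * ‖x‖ ^ 2} := by
    ext x
    simp [b.repr_apply_apply, hb0]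
  rw [hpre, ← Measure.map_apply b.repr.continuous.measurable hS, map_stdComplexNormalVec,
    ← (measurePreserving_toLp_stdComplexNormalVec (n + 1)).measure_preimage hS.nullMeasurableSet,
    ← pi_stdComplexNormal_cone n hd hd1]
  congr 1
  ext x
  simp [EuclideanSpace.norm_sq_eq]

/-! ### Hermitian matrices as functions of their entries above the diagonal. -/

theorem sum_sum_eq_sum_diag_add_sum_lt {n : ℕ} {M : Type*} [AddCommMonoid M]
    (f : Fin n → Fin n → M) :
    ∑ i, ∑ j, f i j = ∑ i, f i i +
      ∑ p : {p : Fin n × Fin n // p.1 < p.2}, (f p.1.1 p.1.2 + f p.1.2 p.1.1) := by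
  have hlt : ∀ g : Fin n × Fin n → M, ∑ p : {p : Fin n × Fin n // p.1 < p.2}, g p.1 =
      ∑ p : Fin n × Fin n, if p.1 < p.2 then g p else 0 := fun g => by
    rw [← Finset.sum_filter, Finset.sum_subtype (p := fun p : Fin n × Fin n => p.1 < p.2)]
    simp
  have hdiag : ∑ i, f i i = ∑ p : Fin n × Fin n, if p.1 = p.2 then f p.1 p.2 else 0 := by
    rw [Fintype.sum_prod_type]; simp
  have hswap : ∑ p : Fin n × Fin n, (if p.1 < p.2 then f p.2 p.1 else 0) =
      ∑ p : Fin n × Fin n, if p.2 < p.1 then f p.1 p.2 else 0 :=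
    (Equiv.prodComm (Fin n) (Fin n)).sum_comp
      (fun p : Fin n × Fin n => if p.2 < p.1 then f p.1 p.2 else 0)
  rw [Finset.sum_add_distrib, hlt fun p => f p.1 p.2, hlt fun p => f p.2 p.1, hswap, hdiag,
    ← Finset.sum_add_distrib, ← Finset.sum_add_distrib, ← Fintype.sum_prod_type']
  refine Finset.sum_congr rfl fun p _ => ?_
  rcases lt_trichotomy p.1 p.2 with h | h | h
  · simp [h, h.ne, h.not_gt]
  · simp [h]
  · simp [h, h.ne', h.not_gt]

/-- The Hermitian matrix with zero diagonal and the given entries above the diagonal. -/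
def hermitianOfUpper {n : ℕ} (X : {p : Fin n × Fin n // p.1 < p.2} → ℂ) :
    Matrix (Fin n) (Fin n) ℂ :=
  Matrix.of fun i j => if h : i < j then X ⟨(i, j), h⟩
    else if h : j < i then starRingEnd ℂ (X ⟨(j, i), h⟩) else 0

section hermitianOfUpper

variable {n : ℕ} (X : {p : Fin n × Fin n // p.1 < p.2} → ℂ)

theorem hermitianOfUpper_apply_lt (p : {p : Fin n × Fin n // p.1 < p.2}) :
    hermitianOfUpper X p.1.1 p.1.2 = X p := by
  simp [hermitianOfUpper, p.2]

theorem hermitianOfUpper_apply_gt (p : {p : Fin n × Fin n // p.1 < p.2}) :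
    hermitianOfUpper X p.1.2 p.1.1 = starRingEnd ℂ (X p) := by
  simp [hermitianOfUpper, p.2, p.2.not_gt]

theorem hermitianOfUpper_apply_self (i : Fin n) : hermitianOfUpper X i i = 0 := by
  simp [hermitianOfUpper]

theorem isHermitian_hermitianOfUpper : (hermitianOfUpper X).IsHermitian := by
  refine Matrix.IsHermitian.ext fun i j => ?_
  rcases lt_trichotomy i j with h | rfl | h
  · simp [hermitianOfUpper, h, h.not_gt]
  · simp [hermitianOfUpper]
  · simp [hermitianOfUpper, h, h.not_gt]

theorem eq_hermitianOfUpper {A : Matrix (Fin n) (Fin n) ℂ} (hA : A.IsHermitian)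
    (h0 : ∀ i, A i i = 0) :
    A = hermitianOfUpper fun p : {p : Fin n × Fin n // p.1 < p.2} => A p.1.1 p.1.2 := by
  ext i j
  rcases lt_trichotomy i j with h | rfl | h
  · simp [hermitianOfUpper, h]
  · simp [hermitianOfUpper, h0]
  · simp only [hermitianOfUpper, Matrix.of_apply, h, h.not_gt, dite_true, dite_false]
    exact (hA.apply i j).symm

theorem continuous_hermitianOfUpper : Continuous (hermitianOfUpper (n := n)) := by
  refine continuous_matrix fun i j => ?_
  unfold hermitianOfUpper
  simp only [Matrix.of_apply]
  split_ifs <;> fun_prop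

theorem re_inner_toEuclideanCLM_hermitianOfUpper (x : EuclideanSpace ℂ (Fin n)) :
    (inner ℂ x (Matrix.toEuclideanCLM (n := Fin n) (𝕜 := ℂ) (hermitianOfUpper X) x)).re =
      ∑ p : {p : Fin n × Fin n // p.1 < p.2},
        (2 * starRingEnd ℂ (x p.1.1) * x p.1.2 * X p).re := by
  have : (inner ℂ x (Matrix.toEuclideanCLM (n := Fin n) (𝕜 := ℂ) (hermitianOfUpper X) x)).re =
      ∑ i, ∑ j, (starRingEnd ℂ (x i) * hermitianOfUpper X i j * x j).re := by
    rw [PiLp.inner_apply, Complex.re_sum]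
    refine Finset.sum_congr rfl fun i _ => ?_
    rw [Matrix.ofLp_toEuclideanCLM, ← Complex.re_sum, Matrix.mulVec, dotProduct,
      RCLike.inner_apply, mul_comm, Finset.mul_sum]
    simp_rw [mul_assoc]
  rw [this, sum_sum_eq_sum_diag_add_sum_lt]
  simp_rw [hermitianOfUpper_apply_lt, hermitianOfUpper_apply_gt, hermitianOfUpper_apply_self]
  simp only [mul_zero, zero_mul, Complex.zero_re, Finset.sum_const_zero, zero_add]
  refine Finset.sum_congr rfl fun p _ => ?_
  simp
  ring

/-- Expanding `(∑ ‖x i‖²)²` gives each pair twice, plus a nonnegative diagonal. This controls the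
variance of the quadratic form at `x`. -/
theorem sum_norm_sq_mul_norm_sq_le (x : EuclideanSpace ℂ (Fin n)) :
    2 * ∑ p : {p : Fin n × Fin n // p.1 < p.2}, ‖x p.1.1‖ ^ 2 * ‖x p.1.2‖ ^ 2 ≤ ‖x‖ ^ 4 := by
  have h : ‖x‖ ^ 4 = ∑ i, ∑ j, ‖x i‖ ^ 2 * ‖x j‖ ^ 2 := by
    rw [← Finset.sum_mul_sum, ← EuclideanSpace.norm_sq_eq]; ring
  rw [h, sum_sum_eq_sum_diag_add_sum_lt, Finset.mul_sum]
  refine le_add_of_nonneg_of_le (by positivity) (Finset.sum_le_sum fun p _ => ?_)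
  linarith [mul_comm (‖x p.1.1‖ ^ 2) (‖x p.1.2‖ ^ 2)]

/-- The coefficients of the real linear functional `Re (ζ (H z)ᵢ)` of the entries above the
diagonal of `H`. -/
def mulVecCoeff (z : Fin n → ℂ) (i : Fin n) (ζ : ℂ) (p : {p : Fin n × Fin n // p.1 < p.2}) : ℂ :=
  if p.1.1 = i then ζ * z p.1.2 else if p.1.2 = i then starRingEnd ℂ (ζ * z p.1.1) else 0

theorem re_mul_mulVec_hermitianOfUpper (z : Fin n → ℂ) (i : Fin n) (ζ : ℂ) :
    (ζ * (hermitianOfUpper X *ᵥ z) i).re = ∑ p, (mulVecCoeff z i ζ p * X p).re := by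
  have : (ζ * (hermitianOfUpper X *ᵥ z) i).re =
      ∑ a, ∑ j, if a = i then (ζ * (hermitianOfUpper X a j * z j)).re else 0 := by
    rw [Finset.sum_comm]
    simp only [Finset.sum_ite_eq', Finset.mem_univ, if_true]
    rw [← Complex.re_sum, Matrix.mulVec, dotProduct, Finset.mul_sum]
  rw [this, sum_sum_eq_sum_diag_add_sum_lt]
  simp_rw [hermitianOfUpper_apply_lt, hermitianOfUpper_apply_gt, hermitianOfUpper_apply_self]
  simp only [mul_zero, zero_mul, Complex.zero_re, ite_self, Finset.sum_const_zero, zero_add]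
  refine Finset.sum_congr rfl fun p _ => ?_
  have := p.2.ne
  unfold mulVecCoeff
  by_cases h1 : p.1.1 = i
  · have h2 : p.1.2 ≠ i := fun h => this (h1.trans h.symm)
    simp only [h1, h2, if_true, if_false, add_zero]
    ring_nf
  · by_cases h2 : p.1.2 = i
    · simp only [h1, h2, if_true, if_false, zero_add]
      -- Row `i` contains the conjugate of this entry; conjugating inside the real part makes the
      -- functional complex linear in the entry itself.
      rw [← Complex.conj_re]
      simp only [map_mul, Complex.conj_conj]
      ring_nf
    · simp [h1, h2]

theorem sum_norm_mulVecCoeff_sq_le {z : Fin n → ℂ} (hz : ∀ i, ‖z i‖ = 1) (i : Fin n) {ζ : ℂ}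
    (hζ : ‖ζ‖ = 1) : ∑ p, ‖mulVecCoeff z i ζ p‖ ^ 2 ≤ n := by
  -- `n` counts the cells of row `i`, so the split into pairs allows a termwise comparison.
  have h : (n : ℝ) = ∑ a : Fin n, ∑ _j : Fin n, if a = i then (1 : ℝ) else 0 := by
    rw [Finset.sum_comm]; simp
  rw [h, sum_sum_eq_sum_diag_add_sum_lt]
  refine le_add_of_nonneg_of_le (Finset.sum_nonneg fun a _ => by positivity)
    (Finset.sum_le_sum fun p _ => ?_)
  unfold mulVecCoeff
  split_ifs <;> simp [hz, hζ]

end hermitianOfUpper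

/-! ### Extremal eigenvectors and quadratic forms of self-adjoint operators. -/

section Rayleigh

variable {E : Type*} [NormedAddCommGroup E] [InnerProductSpace ℂ E] [CompleteSpace E]

/-- The spectral radius of a self-adjoint operator is its norm and is attained; the spectrum is real
and, in finite dimension, consists of eigenvalues. -/
theorem IsSelfAdjoint.exists_apply_eq_norm_smul [FiniteDimensional ℂ E] {T : E →L[ℂ] E}
    (hT : IsSelfAdjoint T) (h0 : T ≠ 0) :
    ∃ v : E, ‖v‖ = 1 ∧ ∃ ε : ℝ, (ε = 1 ∨ ε = -1) ∧ T v = ((ε * ‖T‖ : ℝ) : ℂ) • v := by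
  have : Nontrivial E := by
    by_contra h
    rw [not_nontrivial_iff_subsingleton] at h
    exact h0 (Subsingleton.elim _ _)
  obtain ⟨k, hk, hkn⟩ := spectrum.exists_nnnorm_eq_spectralRadius T
  rw [hT.spectralRadius_eq_nnnorm, ENNReal.coe_inj] at hkn
  have hre : k = k.re := hT.mem_spectrum_eq_re hk
  have hkn' : |k.re| = ‖T‖ := by
    have h := congrArg NNReal.toReal hkn
    rw [coe_nnnorm, coe_nnnorm, hre] at h
    simpa using h
  rw [ContinuousLinearMap.spectrum_eq] at hk
  obtain ⟨w, hw⟩ := (Module.End.hasEigenvalue_iff_mem_spectrum.2 hk).exists_hasEigenvector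
  have hw0 : ‖w‖ ≠ 0 := norm_ne_zero_iff.2 hw.2
  have hTw : T w = k • w := hw.apply_eq_smul
  refine ⟨((‖w‖⁻¹ : ℝ) : ℂ) • w, ?_, ?_⟩
  · rw [norm_smul]; simp [hw0]
  have hTv : T (((‖w‖⁻¹ : ℝ) : ℂ) • w) = k • (((‖w‖⁻¹ : ℝ) : ℂ) • w) := by
    rw [map_smul, hTw, smul_comm]
  rcases abs_choice k.re with h | h
  · refine ⟨1, Or.inl rfl, ?_⟩
    rw [hTv, ← hkn', h, one_mul, ← hre]
  · refine ⟨-1, Or.inr rfl, ?_⟩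
    rw [hTv, ← hkn', h, neg_one_mul, neg_neg, ← hre]

/-- Vectors close to an eigenvector of extremal eigenvalue have a large quadratic form. -/
theorem IsSelfAdjoint.mul_norm_sq_le_of_cone {T : E →L[ℂ] E}
    (hT : IsSelfAdjoint T) {v : E} (hv : ‖v‖ = 1) {ε : ℝ} (hε : ε = 1 ∨ ε = -1)
    (hTv : T v = ((ε * ‖T‖ : ℝ) : ℂ) • v) {d : ℝ} {x : E}
    (hx : ‖x‖ ^ 2 - ‖inner ℂ v x‖ ^ 2 ≤ d * ‖x‖ ^ 2) :
    ‖T‖ * (1 - 2 * d) * ‖x‖ ^ 2 ≤ ε * (inner ℂ x (T x)).re := by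
  set a : ℂ := inner ℂ v x with ha
  -- The cross terms vanish in `x = a • v + y`, so `ε⟨x, Tx⟩ ≥ ‖T‖(‖a‖² - ‖y‖²) = ‖T‖(‖x‖² -
  -- 2‖y‖²)`, with `‖y‖² ≤ d‖x‖²`.
  set y : E := x - a • v with hy
  have hvv : inner ℂ v v = (1 : ℂ) := by rw [inner_self_eq_norm_sq_to_K, hv]; simp
  have hvy : inner ℂ v y = 0 := by rw [hy, inner_sub_right, inner_smul_right, hvv, ← ha]; simp
  have hyv : inner ℂ y v = 0 := by rw [← inner_conj_symm, hvy, map_zero]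
  have hxy : x = a • v + y := by rw [hy]; abel
  have hvTy : inner ℂ v (T y) = 0 := by
    have : inner ℂ v (T y) = inner ℂ (T v) y := (hT.isSymmetric v y).symm
    rw [this, hTv, inner_smul_left, hvy, mul_zero]
  have hyTv : inner ℂ y (T v) = 0 := by rw [hTv, inner_smul_right, hyv, mul_zero]
  have hn : ‖x‖ ^ 2 = ‖a‖ ^ 2 + ‖y‖ ^ 2 := by
    rw [hxy, sq, norm_add_sq_eq_norm_sq_add_norm_sq_of_inner_eq_zero (𝕜 := ℂ) _ _
      (by rw [inner_smul_left, hvy, mul_zero]), norm_smul, hv]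
    ring
  have hq : (inner ℂ x (T x)).re = ε * ‖T‖ * ‖a‖ ^ 2 + (inner ℂ y (T y)).re := by
    have : inner ℂ x (T x) = ((ε * ‖T‖ * ‖a‖ ^ 2 : ℝ) : ℂ) + inner ℂ y (T y) := by
      rw [hxy, map_add, map_smul, inner_add_left, inner_add_right, inner_add_right,
        inner_smul_left, inner_smul_right, inner_smul_left, inner_smul_right, hvTy, hyTv, hTv,
        inner_smul_right, hvv]
      have : starRingEnd ℂ a * a = ((‖a‖ ^ 2 : ℝ) : ℂ) := by
        rw [mul_comm, Complex.mul_conj, Complex.normSq_eq_norm_sq]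
      push_cast at this ⊢
      linear_combination (ε * ‖T‖ : ℂ) * this
    rw [this, Complex.add_re, Complex.ofReal_re]
  have hyT : |(inner ℂ y (T y)).re| ≤ ‖T‖ * ‖y‖ ^ 2 := by
    refine (Complex.abs_re_le_norm _).trans ((norm_inner_le_norm _ _).trans ?_)
    nlinarith [T.le_opNorm y, norm_nonneg y]
  have habs := abs_le.1 hyT
  have hT0 := norm_nonneg T
  have hyd : ‖y‖ ^ 2 ≤ d * ‖x‖ ^ 2 := by linarith
  have h1 := mul_le_mul_of_nonneg_left hyd hT0
  rw [hq]
  rcases hε with rfl | rfl <;> nlinarith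

end Rayleigh

/-! ### First and second moments of the entries. -/

theorem integral_stdComplexNormal_id : ∫ z, z ∂stdComplexNormal = 0 := by
  have h := measurePreserving_stdComplexNormal.integral_comp' (g := fun z : ℂ => z)
  rw [← h]
  have h1 : ∀ p : ℝ × ℝ, Complex.measurableEquivRealProd.symm p = (p.1 : ℂ) + p.2 * Complex.I :=
    fun p => by
      simp [Complex.measurableEquivRealProd_symm_apply, Complex.ext_iff]
  have hi : Integrable (fun x : ℝ => (x : ℂ)) (gaussianReal 0 (1 / 2 : ℝ≥0)) :=
    ((memLp_id_gaussianReal 1).integrable le_rfl).ofReal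
  simp_rw [h1]
  rw [integral_add (hi.comp_fst _) ((hi.comp_snd _).mul_const _), integral_mul_const,
    integral_fun_fst (fun x : ℝ => (x : ℂ)), integral_fun_snd (fun x : ℝ => (x : ℂ)),
    integral_complex_ofReal, integral_id_gaussianReal]
  simp

theorem integral_sq_gaussianReal_half : ∫ x, x ^ 2 ∂gaussianReal 0 (1 / 2 : ℝ≥0) = 1 / 2 := by
  have h := variance_fun_id_gaussianReal (μ := 0) (v := (1 / 2 : ℝ≥0))
  rw [variance_eq_integral (by fun_prop)] at h
  simpa using h

theorem integrable_sq_gaussianReal_half :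
    Integrable (fun x : ℝ => x ^ 2) (gaussianReal 0 (1 / 2 : ℝ≥0)) :=
  (memLp_id_gaussianReal 2).integrable_sq

theorem integral_norm_sq_stdComplexNormal : ∫ z, ‖z‖ ^ 2 ∂stdComplexNormal = 1 := by
  have h := measurePreserving_stdComplexNormal.integral_comp' (g := fun z : ℂ => ‖z‖ ^ 2)
  rw [← h]
  simp_rw [norm_sq_measurableEquivRealProd_symm]
  have hi := integrable_sq_gaussianReal_half
  rw [integral_add (hi.comp_fst _) (hi.comp_snd _),
    integral_fun_fst (fun x : ℝ => x ^ 2), integral_fun_snd (fun x : ℝ => x ^ 2),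
    integral_sq_gaussianReal_half]
  simp
  norm_num

theorem memLp_two_stdComplexNormal : MemLp (fun z : ℂ => z) 2 stdComplexNormal := by
  refine (memLp_two_iff_integrable_sq_norm (by fun_prop)).2 ?_
  exact .of_integral_ne_zero (by rw [integral_norm_sq_stdComplexNormal]; exact one_ne_zero)

theorem IsComplexWigner.moments {Ω : Type*} [MeasurableSpace Ω] {μ : Measure Ω} {n : ℕ}
    {W : Ω → Matrix (Fin n) (Fin n) ℂ} (hW : IsComplexWigner μ W) {i j : Fin n} (hij : i ≠ j) :
    MemLp (fun ω => W ω i j) 2 μ ∧ ∫ ω, W ω i j ∂μ = 0 ∧ ∫ ω, ‖W ω i j‖ ^ 2 ∂μ = 1 := by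
  have key : ∀ i j, i < j →
      MemLp (fun ω => W ω i j) 2 μ ∧ ∫ ω, W ω i j ∂μ = 0 ∧ ∫ ω, ‖W ω i j‖ ^ 2 ∂μ = 1 := by
    intro i j h
    have hl := hW.hasLaw i j h
    refine ⟨?_, ?_, ?_⟩
    · have := memLp_two_stdComplexNormal
      rw [← hl.map_eq] at this
      exact this.comp_of_map hl.aemeasurable
    · rw [← integral_stdComplexNormal_id]
      exact hl.integral_comp (f := fun z => z) (by fun_prop)
    · rw [← integral_norm_sq_stdComplexNormal]
      exact hl.integral_comp (f := fun z => ‖z‖ ^ 2) (by fun_prop)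
  rcases hij.lt_or_gt with h | h
  · exact key i j h
  · obtain ⟨h1, h2, h3⟩ := key j i h
    have hae : (fun ω => W ω i j) =ᵐ[μ] fun ω => starRingEnd ℂ (W ω j i) := by
      filter_upwards [hW.isHermitian] with ω hω
      exact (hω.apply i j).symm
    refine ⟨?_, ?_, ?_⟩
    · exact (memLp_congr_ae hae).2 h1.star
    · rw [integral_congr_ae hae, integral_conj, h2, map_zero]
    · rw [← h3]
      refine integral_congr_ae ?_
      filter_upwards [hae] with ω hω
      rw [hω, RCLike.norm_conj]

/-! ### The sup norm bound. -/

/-- Chernoff's bound for a real linear functional of independent standard complex normals. -/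
theorem pi_stdComplexNormal_re_sum_ge_le {ι : Type*} [Fintype ι] (c : ι → ℂ) {S u : ℝ}
    (hS : 0 < S) (hc : ∑ p, ‖c p‖ ^ 2 ≤ S) (hu : 0 ≤ u) :
    Measure.pi (fun _ : ι => stdComplexNormal) {X | u ≤ ∑ p, (c p * X p).re} ≤
      ENNReal.ofReal (Real.exp (-(u ^ 2 / S))) := by
  -- The minimiser of the exponent `t² S / 4 - t u`.
  set t : ℝ := 2 * u / S with ht
  have ht0 : 0 ≤ t := by positivity
  have hI := lintegral_exp_sum_re_mul_pi (fun p => (t : ℂ) * c p)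
  have hmark := mul_meas_ge_le_lintegral₀ (μ := Measure.pi (fun _ : ι => stdComplexNormal))
    (f := fun X => ENNReal.ofReal (Real.exp (∑ p, ((t : ℂ) * c p * X p).re))) (by fun_prop)
    (ENNReal.ofReal (Real.exp (t * u)))
  rw [hI] at hmark
  have hsub : {X : ι → ℂ | u ≤ ∑ p, (c p * X p).re} ⊆ {X | ENNReal.ofReal (Real.exp (t * u)) ≤
      ENNReal.ofReal (Real.exp (∑ p, ((t : ℂ) * c p * X p).re))} := by
    intro X hX
    refine ENNReal.ofReal_le_ofReal (Real.exp_le_exp.2 ?_)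
    have : ∑ p, ((t : ℂ) * c p * X p).re = t * ∑ p, (c p * X p).re := by
      rw [Finset.mul_sum]
      refine Finset.sum_congr rfl fun p _ => ?_
      rw [mul_assoc, Complex.re_ofReal_mul]
    rw [this]
    exact mul_le_mul_of_nonneg_left hX ht0
  refine (measure_mono hsub).trans ?_
  have hpos : 0 < Real.exp (t * u) := Real.exp_pos _
  rw [← ENNReal.mul_le_mul_iff_right (ENNReal.ofReal_pos.2 hpos).ne' ENNReal.ofReal_ne_top]
  refine hmark.trans ?_
  rw [← ENNReal.ofReal_mul hpos.le, ← Real.exp_add]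
  refine ENNReal.ofReal_le_ofReal (Real.exp_le_exp.2 ?_)
  have : ∑ p, ‖(t : ℂ) * c p‖ ^ 2 = t ^ 2 * ∑ p, ‖c p‖ ^ 2 := by
    rw [Finset.mul_sum]
    refine Finset.sum_congr rfl fun p _ => ?_
    rw [norm_mul, mul_pow, Complex.norm_real, Real.norm_eq_abs, sq_abs]
  rw [this]
  calc t ^ 2 * (∑ p, ‖c p‖ ^ 2) / 4 ≤ t ^ 2 * S / 4 := by gcongr
    _ = t * u + -(u ^ 2 / S) := by rw [ht]; field_simp; ring

theorem pi_stdComplexNormal_mulVec_gt_le {n : ℕ} (hn : 2 ≤ n) {z : Fin n → ℂ}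
    (hz : ∀ i, ‖z i‖ = 1) :
    Measure.pi (fun _ : {p : Fin n × Fin n // p.1 < p.2} => stdComplexNormal)
      {X | 3 * √((n : ℝ) * Real.log n) < ‖hermitianOfUpper X *ᵥ z‖} ≤
      ENNReal.ofReal (2 * (n : ℝ) ^ (-(5 / 4) : ℝ)) := by
  have hn2 : (2 : ℝ) ≤ n := by exact_mod_cast hn
  have hn0 : (0 : ℝ) < n := by linarith
  have hlog : 0 ≤ Real.log n := Real.log_nonneg (by linarith)
  -- The threshold divided by `√2`: a complex number whose real and imaginary parts are below `u` in
  -- absolute value has modulus below `√2 u`.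
  set u : ℝ := √(9 / 2 * (n * Real.log n)) with hu
  have hu2 : u ^ 2 = 9 / 2 * (n * Real.log n) := Real.sq_sqrt (by positivity)
  have hu0 : 0 ≤ u := Real.sqrt_nonneg _
  have hR2 : (3 * √((n : ℝ) * Real.log n)) ^ 2 = 2 * u ^ 2 := by
    rw [mul_pow, Real.sq_sqrt (by positivity), hu2]; ring
  have hsub : {X : {p : Fin n × Fin n // p.1 < p.2} → ℂ |
      3 * √((n : ℝ) * Real.log n) < ‖hermitianOfUpper X *ᵥ z‖} ⊆
      ⋃ q : Fin n × Fin 4, {X | u ≤ ∑ p, (mulVecCoeff z q.1 (Complex.I ^ (q.2 : ℕ)) p * X p).re} := by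
    intro X hX
    simp only [Set.mem_iUnion, Set.mem_ofPred_eq] at hX ⊢
    simp_rw [← re_mul_mulVec_hermitianOfUpper]
    have : ∃ i, 3 * √((n : ℝ) * Real.log n) < ‖(hermitianOfUpper X *ᵥ z) i‖ := by
      by_contra! h
      exact absurd ((pi_norm_le_iff_of_nonneg (by positivity)).2 h) (not_le.2 hX)
    obtain ⟨i, hi⟩ := this
    set w := (hermitianOfUpper X *ᵥ z) i with hw
    have hw2 : 2 * u ^ 2 < w.re ^ 2 + w.im ^ 2 := by
      rw [← hR2]
      have := pow_lt_pow_left₀ hi (by positivity) two_ne_zero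
      rwa [← Complex.normSq_eq_norm_sq, Complex.normSq_apply, ← sq, ← sq] at this
    by_contra! h
    have h0 := h (i, 0)
    have h1 := h (i, 1)
    have h2 := h (i, 2)
    have h3 := h (i, 3)
    simp only [← hw] at h0 h1 h2 h3
    simp [pow_succ] at h0 h1 h2 h3
    nlinarith
  refine (measure_mono hsub).trans ((measure_iUnion_fintype_le _ _).trans ?_)
  have hle : ∀ q : Fin n × Fin 4, Measure.pi (fun _ : {p : Fin n × Fin n // p.1 < p.2} =>
      stdComplexNormal) {X | u ≤ ∑ p, (mulVecCoeff z q.1 (Complex.I ^ (q.2 : ℕ)) p * X p).re} ≤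
      ENNReal.ofReal (Real.exp (-(u ^ 2 / n))) := fun q =>
    pi_stdComplexNormal_re_sum_ge_le _ hn0 (sum_norm_mulVecCoeff_sq_le hz _ (by simp)) hu0
  refine (Finset.sum_le_sum fun q _ => hle q).trans ?_
  rw [Finset.sum_const, Finset.card_univ, Fintype.card_prod, Fintype.card_fin, Fintype.card_fin,
    ← ENNReal.ofReal_nsmul]
  refine ENNReal.ofReal_le_ofReal ?_
  have hexp : Real.exp (-(u ^ 2 / n)) = (n : ℝ) ^ (-(9 / 2) : ℝ) := by
    rw [hu2, Real.rpow_def_of_pos hn0]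
    congr 1
    field_simp
  have hsplit : (n : ℝ) ^ (-(9 / 2) : ℝ) =
      (n : ℝ) ^ (-(5 / 4) : ℝ) * (n : ℝ) ^ (-(13 / 4) : ℝ) := by
    rw [← Real.rpow_add hn0]; norm_num
  -- There is room to spare: `4n · n⁻² ≤ 2` already holds for `n ≥ 2`.
  have hsmall : (n : ℝ) ^ (-(13 / 4) : ℝ) ≤ (n : ℝ) ^ (-2 : ℝ) :=
    Real.rpow_le_rpow_of_exponent_le (by linarith) (by norm_num)
  have hsq : (n : ℝ) ^ (-2 : ℝ) = ((n : ℝ) ^ 2)⁻¹ := by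
    rw [Real.rpow_neg hn0.le]; norm_cast
  have hfin : n * 4 * (n : ℝ) ^ (-2 : ℝ) ≤ 2 := by
    rw [hsq]
    field_simp
    linarith
  rw [hexp, hsplit, nsmul_eq_mul]
  push_cast
  have hp : 0 ≤ (n : ℝ) ^ (-(5 / 4) : ℝ) := by positivity
  calc (n : ℝ) * 4 * ((n : ℝ) ^ (-(5 / 4) : ℝ) * (n : ℝ) ^ (-(13 / 4) : ℝ))
      ≤ (n : ℝ) * 4 * ((n : ℝ) ^ (-(5 / 4) : ℝ) * (n : ℝ) ^ (-2 : ℝ)) := by gcongr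
    _ = (n * 4 * (n : ℝ) ^ (-2 : ℝ)) * (n : ℝ) ^ (-(5 / 4) : ℝ) := by ring
    _ ≤ 2 * (n : ℝ) ^ (-(5 / 4) : ℝ) := by gcongr

/-! ### The operator norm bound. -/

/-- The Rayleigh quotient of the Hermitian matrix with the given entries above the diagonal. -/
noncomputable def hermitianRayleigh {n : ℕ} (X : {p : Fin n × Fin n // p.1 < p.2} → ℂ)
    (x : EuclideanSpace ℂ (Fin n)) : ℝ :=
  (inner ℂ x (Matrix.toEuclideanCLM (n := Fin n) (𝕜 := ℂ) (hermitianOfUpper X) x)).re / ‖x‖ ^ 2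

theorem hermitianRayleigh_eq {n : ℕ} (X : {p : Fin n × Fin n // p.1 < p.2} → ℂ)
    (x : EuclideanSpace ℂ (Fin n)) : hermitianRayleigh X x =
      (∑ p : {p : Fin n × Fin n // p.1 < p.2},
        (2 * starRingEnd ℂ (x p.1.1) * x p.1.2 * X p).re) / ‖x‖ ^ 2 := by
  rw [hermitianRayleigh, re_inner_toEuclideanCLM_hermitianOfUpper]

theorem measurable_hermitianRayleigh {n : ℕ} :
    Measurable (Function.uncurry (hermitianRayleigh (n := n))) := by
  have : Function.uncurry (hermitianRayleigh (n := n)) = fun q =>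
      (∑ p : {p : Fin n × Fin n // p.1 < p.2},
        (2 * starRingEnd ℂ (q.2 p.1.1) * q.2 p.1.2 * q.1 p).re) / ‖q.2‖ ^ 2 :=
    funext fun q => hermitianRayleigh_eq q.1 q.2
  rw [this]
  refine Measurable.div (Continuous.measurable ?_) (Continuous.measurable ?_)
  · have h : ∀ i, Continuous fun q : ({p : Fin n × Fin n // p.1 < p.2} → ℂ) ×
        EuclideanSpace ℂ (Fin n) => q.2 i := fun i => by fun_prop
    have h' : ∀ p, Continuous fun q : ({p : Fin n × Fin n // p.1 < p.2} → ℂ) ×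
        EuclideanSpace ℂ (Fin n) => q.1 p := fun p => by fun_prop
    refine continuous_finsetSum _ fun p _ => Complex.continuous_re.comp ?_
    exact ((continuous_const.mul (Complex.continuous_conj.comp (h _))).mul (h _)).mul (h' _)
  · fun_prop

/-- For fixed `x` the quotient is a centred real Gaussian of variance at most 1, whatever the
dimension. -/
theorem lintegral_exp_hermitianRayleigh_le {n : ℕ} (s : ℝ) (x : EuclideanSpace ℂ (Fin n)) :
    ∫⁻ X, ENNReal.ofReal (Real.exp (s * hermitianRayleigh X x))
        ∂Measure.pi (fun _ : {p : Fin n × Fin n // p.1 < p.2} => stdComplexNormal) ≤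
      ENNReal.ofReal (Real.exp (s ^ 2 / 2)) := by
  set a : ℝ := s / ‖x‖ ^ 2 with ha
  set c : {p : Fin n × Fin n // p.1 < p.2} → ℂ :=
    fun p => a * (2 * starRingEnd ℂ (x p.1.1) * x p.1.2) with hc
  have h1 : ∀ X : {p : Fin n × Fin n // p.1 < p.2} → ℂ,
      s * hermitianRayleigh X x = ∑ p, (c p * X p).re := by
    intro X
    rw [hermitianRayleigh_eq, mul_div_assoc', mul_comm s, mul_div_assoc, ← ha, Finset.sum_mul]
    refine Finset.sum_congr rfl fun p _ => ?_
    rw [hc]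
    simp only
    rw [mul_assoc (a : ℂ), Complex.re_ofReal_mul, mul_comm]
  simp_rw [h1]
  rw [lintegral_exp_sum_re_mul_pi]
  refine ENNReal.ofReal_le_ofReal (Real.exp_le_exp.2 ?_)
  have h2 : ∑ p, ‖c p‖ ^ 2 = 2 * a ^ 2 *
      (2 * ∑ p : {p : Fin n × Fin n // p.1 < p.2}, ‖x p.1.1‖ ^ 2 * ‖x p.1.2‖ ^ 2) := by
    simp_rw [Finset.mul_sum]
    refine Finset.sum_congr rfl fun p _ => ?_
    simp only [hc, norm_mul, Complex.norm_real, Real.norm_eq_abs, RCLike.norm_conj, mul_pow, sq_abs,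
      Complex.norm_ofNat]
    ring
  -- Only an inequality, because division by zero gives `a = 0` at `x = 0`.
  have h3 : a ^ 2 * ‖x‖ ^ 4 ≤ s ^ 2 := by
    rcases eq_or_ne ‖x‖ 0 with h | h
    · rw [h]; norm_num; positivity
    · rw [ha]; field_simp; rfl
  rw [h2]
  have h4 := mul_le_mul_of_nonneg_left (sum_norm_sq_mul_norm_sq_le x) (sq_nonneg a)
  linarith

theorem lintegral_lintegral_exp_hermitianRayleigh_le {n : ℕ} (s : ℝ) :
    ∫⁻ X, ∫⁻ x, ENNReal.ofReal (Real.exp (s * hermitianRayleigh X x)) ∂stdComplexNormalVec n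
        ∂Measure.pi (fun _ : {p : Fin n × Fin n // p.1 < p.2} => stdComplexNormal) ≤
      ENNReal.ofReal (Real.exp (s ^ 2 / 2)) := by
  rw [lintegral_lintegral_swap
    ((measurable_hermitianRayleigh.const_mul s).exp.ennreal_ofReal.aemeasurable)]
  refine (lintegral_mono fun x => lintegral_exp_hermitianRayleigh_le s x).trans ?_
  simp

/-- A large operator norm forces a large exponential moment of the Rayleigh quotient. -/
theorem le_lintegral_exp_hermitianRayleigh {n : ℕ}
    (X : {p : Fin (n + 1) × Fin (n + 1) // p.1 < p.2} → ℂ) {R d s : ℝ} (hR : 0 ≤ R) (hd : 0 < d)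
    (hd1 : d ≤ 1 / 2) (hs : 0 ≤ s)
    (hX : R < ‖Matrix.toEuclideanCLM (n := Fin (n + 1)) (𝕜 := ℂ) (hermitianOfUpper X)‖) :
    ∃ ε : ℝ, (ε = 1 ∨ ε = -1) ∧ ENNReal.ofReal (Real.exp (s * (R * (1 - 2 * d))) * d ^ n) ≤
      ∫⁻ x, ENNReal.ofReal (Real.exp (ε * s * hermitianRayleigh X x))
        ∂stdComplexNormalVec (n + 1) := by
  set T := Matrix.toEuclideanCLM (n := Fin (n + 1)) (𝕜 := ℂ) (hermitianOfUpper X) with hT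
  have hsa : IsSelfAdjoint T :=
    IsSelfAdjoint.map (isHermitian_hermitianOfUpper X).isSelfAdjoint
      (Matrix.toEuclideanCLM (n := Fin (n + 1)) (𝕜 := ℂ))
  have hT0 : T ≠ 0 := norm_pos_iff.1 (hR.trans_lt hX)
  obtain ⟨v, hv, ε, hε, hTv⟩ := hsa.exists_apply_eq_norm_smul hT0
  refine ⟨ε, hε, ?_⟩
  have hS : MeasurableSet {x : EuclideanSpace ℂ (Fin (n + 1)) |
      ‖x‖ ^ 2 - ‖inner ℂ v x‖ ^ 2 < d * ‖x‖ ^ 2} := measurableSet_lt (by fun_prop) (by fun_prop)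
  rw [ENNReal.ofReal_mul (Real.exp_pos _).le, ← stdComplexNormalVec_cone n hd (by linarith) hv,
    ← setLIntegral_const]
  refine (setLIntegral_mono' hS fun x hx => ?_).trans (setLIntegral_le_lintegral _ _)
  refine ENNReal.ofReal_le_ofReal (Real.exp_le_exp.2 ?_)
  have hx' : ‖x‖ ^ 2 - ‖inner ℂ v x‖ ^ 2 < d * ‖x‖ ^ 2 := hx
  -- The strict inequality defining the cone excludes the origin.
  have hx0 : 0 < ‖x‖ ^ 2 := by
    refine pow_pos (norm_pos_iff.2 ?_) 2
    rintro rfl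
    simp at hx'
  have hq := hsa.mul_norm_sq_le_of_cone hv hε hTv hx'.le
  have hq' : ‖T‖ * (1 - 2 * d) ≤ ε * hermitianRayleigh X x := by
    rw [hermitianRayleigh, ← hT, mul_div_assoc', le_div_iff₀ hx0]
    exact hq
  calc s * (R * (1 - 2 * d)) ≤ s * (‖T‖ * (1 - 2 * d)) := by
        have : 0 ≤ 1 - 2 * d := by linarith
        gcongr
    _ ≤ s * (ε * hermitianRayleigh X x) := by gcongr
    _ = ε * s * hermitianRayleigh X x := by ring

/-- The sign of the extremal eigenvalue depends on the matrix, so Markov's inequality is applied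
with both `s` and `-s`; hence the factor 2. -/
theorem pi_stdComplexNormal_opNorm_gt_le_div (n : ℕ) {R d s : ℝ} (hR : 0 ≤ R) (hd : 0 < d)
    (hd1 : d ≤ 1 / 2) (hs : 0 ≤ s) :
    Measure.pi (fun _ : {p : Fin (n + 1) × Fin (n + 1) // p.1 < p.2} => stdComplexNormal)
      {X | R < ‖Matrix.toEuclideanCLM (n := Fin (n + 1)) (𝕜 := ℂ) (hermitianOfUpper X)‖} ≤
      ENNReal.ofReal (2 * (Real.exp (s ^ 2 / 2) / (Real.exp (s * (R * (1 - 2 * d))) * d ^ n))) := by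
  set K := Real.exp (s * (R * (1 - 2 * d))) * d ^ n with hK
  have hK0 : 0 < K := by positivity
  have hmark : ∀ t : ℝ, t ^ 2 = s ^ 2 →
      Measure.pi (fun _ : {p : Fin (n + 1) × Fin (n + 1) // p.1 < p.2} => stdComplexNormal)
        {X | ENNReal.ofReal K ≤ ∫⁻ x, ENNReal.ofReal (Real.exp (t * hermitianRayleigh X x))
          ∂stdComplexNormalVec (n + 1)} ≤ ENNReal.ofReal (Real.exp (s ^ 2 / 2) / K) := by
    intro t ht
    rw [ENNReal.ofReal_div_of_pos hK0, ← ht]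
    refine (meas_ge_le_lintegral_div ?_ (ENNReal.ofReal_pos.2 hK0).ne' ENNReal.ofReal_ne_top).trans
      (ENNReal.div_le_div_right (lintegral_lintegral_exp_hermitianRayleigh_le t) _)
    exact ((measurable_hermitianRayleigh.const_mul t).exp.ennreal_ofReal.lintegral_prod_right
      ).aemeasurable
  have hsub : {X : {p : Fin (n + 1) × Fin (n + 1) // p.1 < p.2} → ℂ |
      R < ‖Matrix.toEuclideanCLM (n := Fin (n + 1)) (𝕜 := ℂ) (hermitianOfUpper X)‖} ⊆
      {X | ENNReal.ofReal K ≤ ∫⁻ x, ENNReal.ofReal (Real.exp (s * hermitianRayleigh X x))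
          ∂stdComplexNormalVec (n + 1)} ∪
      {X | ENNReal.ofReal K ≤ ∫⁻ x, ENNReal.ofReal (Real.exp (-s * hermitianRayleigh X x))
          ∂stdComplexNormalVec (n + 1)} := by
    intro X hX
    obtain ⟨ε, hε, h⟩ := le_lintegral_exp_hermitianRayleigh X hR hd hd1 hs hX
    rcases hε with rfl | rfl
    · left; simpa using h
    · right; simpa using h
  refine (measure_mono hsub).trans ((measure_union_le _ _).trans ?_)
  refine (add_le_add (hmark s rfl) (hmark (-s) (neg_sq s))).trans ?_
  rw [← ENNReal.ofReal_add (by positivity) (by positivity), two_mul]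

theorem pi_stdComplexNormal_opNorm_gt_le {n : ℕ} (hn : 1 ≤ n) :
    Measure.pi (fun _ : {p : Fin n × Fin n // p.1 < p.2} => stdComplexNormal)
      {X | 3 * √(n : ℝ) < ‖Matrix.toEuclideanCLM (n := Fin n) (𝕜 := ℂ) (hermitianOfUpper X)‖} ≤
      ENNReal.ofReal (Real.exp (-(n : ℝ) / 2)) := by
  obtain ⟨m, rfl⟩ : ∃ m, n = m + 1 := ⟨n - 1, by omega⟩
  set N : ℝ := ((m + 1 : ℕ) : ℝ) with hN
  have hN0 : 0 ≤ N := by positivity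
  have hsq : √N ^ 2 = N := Real.sq_sqrt hN0
  -- For given `d`, the best `s` is `R(1-2d)`. With `d = 1/10` the bound is `2 · 10^(N-1) · exp
  -- (-72N/25)`.
  refine (pi_stdComplexNormal_opNorm_gt_le_div m (R := 3 * √N) (d := 1 / 10)
    (s := 3 * √N * (4 / 5)) (by positivity) (by norm_num) (by norm_num) (by positivity)).trans ?_
  refine ENNReal.ofReal_le_ofReal ?_
  have h1 : (3 * √N * (4 / 5)) ^ 2 / 2 = 72 / 25 * N := by
    rw [mul_pow, mul_pow, hsq]; ring
  have h2 : 3 * √N * (4 / 5) * (3 * √N * (1 - 2 * (1 / 10))) = 144 / 25 * N := by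
    linear_combination 144 / 25 * hsq
  rw [h1, h2, div_mul_eq_div_div, ← Real.exp_sub]
  -- `119/50 = 72/25 - 1/2` is exactly the exponent available to absorb the factor 10 per dimension.
  have h10 : (10 : ℝ) ≤ Real.exp (119 / 50) := by
    have he : Real.exp (119 / 50) = Real.exp 1 ^ 2 * Real.exp (19 / 50) := by
      rw [← Real.exp_nat_mul, ← Real.exp_add]; norm_num
    have h := Real.quadratic_le_exp_of_nonneg (x := 19 / 50) (by norm_num)
    have h' := Real.exp_one_gt_d9
    rw [he]
    nlinarith [Real.exp_pos (19 / 50)]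
  have hpow : (10 : ℝ) ^ (m + 1) ≤ Real.exp (119 / 50 * N) := by
    calc (10 : ℝ) ^ (m + 1) ≤ Real.exp (119 / 50) ^ (m + 1) := by gcongr
      _ = Real.exp (119 / 50 * N) := by rw [← Real.exp_nat_mul, mul_comm]
  have hsplit : Real.exp (-N / 2) =
      Real.exp (72 / 25 * N - 144 / 25 * N) * Real.exp (119 / 50 * N) := by
    rw [← Real.exp_add]; ring_nf
  rw [hsplit, one_div, inv_pow, div_inv_eq_mul]
  have hp : 0 < Real.exp (72 / 25 * N - 144 / 25 * N) := Real.exp_pos _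
  have : 2 * (10 : ℝ) ^ m ≤ Real.exp (119 / 50 * N) := by
    have : 0 < (10 : ℝ) ^ m := by positivity
    rw [pow_succ] at hpow
    linarith
  nlinarith

/-! ### Transfer to the random matrix and conclusion. -/

theorem IsComplexWigner.measure_not_isDiscordant_le {Ω : Type*} [MeasurableSpace Ω]
    {μ : Measure Ω} [IsProbabilityMeasure μ] {n : ℕ} (hn : 2 ≤ n) {z : Fin n → ℂ}
    (hz : ∀ i, ‖z i‖ = 1) {W : Ω → Matrix (Fin n) (Fin n) ℂ} (hW : IsComplexWigner μ W) :
    μ {ω | ¬ IsDiscordant z (W ω)} ≤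
      ENNReal.ofReal (2 * (n : ℝ) ^ (-(5 / 4) : ℝ) + Real.exp (-(n : ℝ) / 2)) := by
  set A : Set ({p : Fin n × Fin n // p.1 < p.2} → ℂ) :=
    {X | 3 * √((n : ℝ) * Real.log n) < ‖hermitianOfUpper X *ᵥ z‖}
  set B : Set ({p : Fin n × Fin n // p.1 < p.2} → ℂ) :=
    {X | 3 * √(n : ℝ) < ‖Matrix.toEuclideanCLM (n := Fin n) (𝕜 := ℂ) (hermitianOfUpper X)‖}
  have hlaw := hW.iIndepFun.hasLaw_pi fun p : {p : Fin n × Fin n // p.1 < p.2} => hW.hasLaw p.1.1 p.1.2 p.2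
  have hA : MeasurableSet A := by
    refine measurableSet_lt measurable_const (Continuous.measurable ?_)
    exact (continuous_hermitianOfUpper.matrix_mulVec continuous_const).norm
  have hB : MeasurableSet B := by
    refine measurableSet_lt measurable_const (Continuous.measurable ?_)
    have : Continuous (Matrix.toEuclideanCLM (n := Fin n) (𝕜 := ℂ)) :=
      LinearMap.continuous_of_finiteDimensional
        (Matrix.toEuclideanCLM (n := Fin n) (𝕜 := ℂ)).toAlgEquiv.toLinearMap
    exact (this.comp continuous_hermitianOfUpper).norm
  have hsub : {ω | ¬ IsDiscordant z (W ω)} ≤ᵐ[μ]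
      {ω | (fun p : {p : Fin n × Fin n // p.1 < p.2} => W ω p.1.1 p.1.2) ∈ A ∪ B} := by
    filter_upwards [hW.isHermitian, hW.diag_eq_zero] with ω h1 h2 h3
    have heq := eq_hermitianOfUpper h1 h2
    by_contra h
    refine h3 ⟨h1, ?_, ?_⟩
    · by_contra hc
      refine h (Or.inr ?_)
      simp only [B, Set.mem_ofPred_eq]
      rw [← heq]
      exact not_le.1 hc
    · by_contra hc
      refine h (Or.inl ?_)
      simp only [A, Set.mem_ofPred_eq]
      rw [← heq]
      exact not_le.1 hc
  refine (measure_mono_ae hsub).trans ?_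
  rw [hlaw.measure_eq (p := fun X => X ∈ A ∪ B) (hA.union hB)]
  refine (measure_union_le _ _).trans ?_
  rw [ENNReal.ofReal_add (by positivity) (by positivity)]
  exact add_le_add (pi_stdComplexNormal_mulVec_gt_le hn hz)
    (pi_stdComplexNormal_opNorm_gt_le (by omega))

theorem proposition3 {Ω : Type*} [MeasurableSpace Ω] (μ : Measure Ω) [IsProbabilityMeasure μ]
    (n : ℕ) (z : Fin n → ℂ) (hz : ∀ i, ‖z i‖ = 1)
    (W : Ω → Matrix (Fin n) (Fin n) ℂ) (hW : IsComplexWigner μ W) :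
    (∀ i j, i ≠ j → MemLp (fun ω => W ω i j) 2 μ ∧
      ∫ ω, W ω i j ∂μ = 0 ∧ ∫ ω, ‖W ω i j‖ ^ 2 ∂μ = 1) ∧
    1 - 2 * (n : ℝ) ^ (-(5 / 4) : ℝ) - Real.exp (-(n : ℝ) / 2) ≤
      μ.real {ω | IsDiscordant z (W ω)} := by
  refine ⟨fun i j hij => hW.moments hij, ?_⟩
  obtain hn | rfl | rfl : 2 ≤ n ∨ n = 1 ∨ n = 0 := by omega
  · have hbad := ENNReal.toReal_mono ENNReal.ofReal_ne_top (hW.measure_not_isDiscordant_le hn hz)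
    rw [ENNReal.toReal_ofReal (by positivity)] at hbad
    -- Subadditivity suffices here and needs no measurability of the discordance event.
    have hadd : (1 : ℝ) ≤ μ.real {ω | IsDiscordant z (W ω)} +
        μ.real {ω | ¬ IsDiscordant z (W ω)} := by
      rw [← probReal_univ (μ := μ)]
      refine le_trans (measureReal_mono fun ω _ => ?_) (measureReal_union_le _ _)
      exact em _
    have : μ.real {ω | ¬ IsDiscordant z (W ω)} ≤ _ := hbad
    linarith
  -- For `n = 1` the claimed lower bound is negative.
  · have := Real.exp_pos (-((1 : ℕ) : ℝ) / 2)
    have h0 : 0 ≤ μ.real {ω | IsDiscordant z (W ω)} := measureReal_nonneg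
    norm_num at this ⊢
    linarith
  -- For `n = 0` the power takes the default value 0, so the lower bound is `1 - 0 - 1 = 0`.
  · have h1 : (0 : ℝ) ^ (-(5 / 4) : ℝ) = 0 := Real.zero_rpow (by norm_num)
    simp [h1]
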